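/- Let $L$ be a countable linear ordering. Let $s(x)$ be the immediate successor of $x$ in $L$ if there is one and $s(x)=x$ otherwise, and let $p(x)$ be the immediate predecessor of $x$ if there is one and $p(x)=x$ otherwise. Suppose that the structure $(L,\le,s,p)$ is weakly homogeneous, that is, there is a finite set of elements $a_1,\dots,a_n\in L$ such that every isomorphism between finitely generated substructures of $(L,\le,s,p)$ which maps each $a_i$ to itself extends to an automorphism of $(L,\le,s,p)$. Then the linear ordering $L=(L,\le)$ is relatively $\Delta^0_4$ categorical: whenever $L_1$ and $L_2$ are linear orderings isomorphic to $L$ whose universes are subsets of $\mathbb N$, there is an isomorphism $f:L_1\to L_2$ whose graph is $\Delta^0_4$ relative to $D(L_1)\oplus D(L_2)$, where $D(L_i)=\{\langle a,b\rangle : a,b\in L_i,\ a\le_{L_i} b\}$ is the atomic diagram of $L_i$. -/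

import Mathlib

open FirstOrder

/-- Function symbols of the language of sp-linear orderings: two unary symbols. -/
inductive SPFunc : ℕ → Type
  | s : SPFunc 1
  | p : SPFunc 1

/-- The language of sp-linear orderings: a binary relation symbol for the order together with
unary function symbols for successor and predecessor. -/
def spLanguage : Language := ⟨SPFunc, Language.orderRel⟩

open Classical in
/-- The immediate successor of `x` if there is one, and `x` itself otherwise. -/
noncomputable def spSucc {L : Type*} [LinearOrder L] (x : L) : L :=
  if h : ∃ y, x ⋖ y then h.choose else x

open Classical in
/-- The immediate predecessor of `x` if there is one, and `x` itself otherwise. -/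
noncomputable def spPred {L : Type*} [LinearOrder L] (x : L) : L :=
  if h : ∃ y, y ⋖ x then h.choose else x

/-- The sp-expansion `(L, s, p)` of a linear ordering. -/
@[reducible] noncomputable def spStructure (L : Type*) [LinearOrder L] : spLanguage.Structure L where
  funMap {_} f v :=
    match f, v with
    | SPFunc.s, v => spSucc (v 0)
    | SPFunc.p, v => spPred (v 0)
  RelMap {_} R v :=
    match R, v with
    | Language.orderRel.le, v => v 0 ≤ v 1

/-- `A` is weakly homogeneous: there is a finite exceptional set `E` such that every isomorphism
between finitely generated substructures of `A` which maps each element of `E` to itself extends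
to an automorphism of `A`. -/
def WeaklyHomogeneous (𝓛 : Language) (A : Type*) [𝓛.Structure A] : Prop :=
  ∃ E : Finset A, ∀ S T : 𝓛.Substructure A, S.FG → T.FG → ∀ f : S ≃[𝓛] T,
    (∀ a ∈ E, ∃ ha : a ∈ S, (f ⟨a, ha⟩ : A) = a) →
      ∃ g : A ≃[𝓛] A, ∀ x : S, g x = f x

/-- The sp-expansion of the linear ordering `L` is weakly homogeneous. -/
def WeaklySPHomogeneous (L : Type*) [LinearOrder L] : Prop :=
  letI := spStructure L
  WeaklyHomogeneous spLanguage L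

open Classical in
/-- The arithmetical hierarchy of sets of natural numbers relative to the oracles `O`:
level `0` consists of the sets computable from `O`, and a `Σ⁰ₙ₊₁(O)` set is of the form
`{x | ∃ y, ⟨x, y⟩ ∈ R}` with the complement of `R` in `Σ⁰ₙ(O)` (that is, with `R` in `Π⁰ₙ(O)`). -/
def IsSigma (O : Set (ℕ →. ℕ)) : ℕ → Set ℕ → Prop
  | 0, S => ComputableIn O fun n => decide (n ∈ S)
  | n + 1, S => ∃ R : Set ℕ, IsSigma O n Rᶜ ∧ S = {x | ∃ y, Nat.pair x y ∈ R}

/-- `Π⁰ₙ(O)` sets: complements of `Σ⁰ₙ(O)` sets. -/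
def IsPi (O : Set (ℕ →. ℕ)) (n : ℕ) (S : Set ℕ) : Prop :=
  IsSigma O n Sᶜ

/-- `Δ⁰ₙ(O)` sets. -/
def IsDelta (O : Set (ℕ →. ℕ)) (n : ℕ) (S : Set ℕ) : Prop :=
  IsSigma O n S ∧ IsPi O n S

/-- A linear ordering whose universe is a (finite or infinite) set of natural numbers. The order
is unrelated to the usual order of the natural numbers. -/
structure OrderPresentation where
  carrier : Set ℕ
  order : LinearOrder carrier

namespace OrderPresentation

/-- The elements of a presentation. This is a copy of the subtype of `ℕ` which does not inherit
the usual order of `ℕ`. -/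
def Elem (P : OrderPresentation) : Type := {n : ℕ // n ∈ P.carrier}

instance instLinearOrderElem (P : OrderPresentation) : LinearOrder P.Elem := P.order

/-- The natural number that an element is. -/
def Elem.toNat {P : OrderPresentation} (a : P.Elem) : ℕ := Subtype.val a

open Classical in
/-- The characteristic function of the atomic diagram, as a total function on codes of pairs: the
value at `⟨a, b⟩` is `1` if `a` and `b` are elements with `a ≤ b`, and `0` otherwise.
In particular `a` is an element iff the value at `⟨a, a⟩` is `1`. -/
noncomputable def diagram (P : OrderPresentation) : ℕ → ℕ := fun n =>
  if ∃ a b : P.Elem, n = Nat.pair a.toNat b.toNat ∧ a ≤ b then 1 else 0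

/-- The graph of an isomorphism of presentations, as a set of codes of pairs. -/
def isoGraph {P Q : OrderPresentation} (f : P.Elem ≃o Q.Elem) : Set ℕ :=
  {n | ∃ a : P.Elem, n = Nat.pair a.toNat (f a).toNat}

end OrderPresentation

/-- `L` is relatively `Δ⁰ₙ` categorical: between any two copies `P`, `Q` of `L` there is an
isomorphism which is `Δ⁰ₙ` relative to (the atomic diagrams of) `P` and `Q`. -/
def RelativelyDeltaCategorical (n : ℕ) (L : Type*) [LinearOrder L] : Prop :=
  ∀ P Q : OrderPresentation, Nonempty (L ≃o P.Elem) → Nonempty (L ≃o Q.Elem) →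
    ∃ f : P.Elem ≃o Q.Elem,
      IsDelta {(P.diagram : ℕ →. ℕ), (Q.diagram : ℕ →. ℕ)} n (OrderPresentation.isoGraph f)

/-! The proof is a back-and-forth construction whose complexity is kept under control. A finite set
of pairs from `P` and `Q` is a matching if its two sides satisfy the same inequalities between terms
in `s` and `p`; as both functions are unary, such terms are words applied to single elements. A
matching of `L` with itself induces an isomorphism of the generated substructures, which by weak
homogeneity extends to an automorphism as soon as the exceptional elements are fixed. Carried over
to the copies, every finite matching that contains the pairs of images of exceptional elements can
absorb any further element on either side (`WeaklySPHomogeneous.exists_insert`).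

Relative to the diagrams, covering is Π₁ and having no cover is Π₂. So `s` and `p` have Σ₃ graphs,
and inequalities between terms are Δ₃ (`sigmaPred_natLe_act`). Being a matching quantifies
universally over words and is therefore Π₃ (`sigmaPred_not_isNatMatching`). Always choosing the
least partner gives a deterministic Σ₄ step (`sigmaPred_isStep`), so the resulting isomorphism has a
Σ₄ graph, and a Σ₄ graph of a function with decidable domain is Δ₄ (`not_mem_isoGraph_iff`). -/

open Encodable

/-! ### Relativized computability -/

section ComputableIn

variable {α β γ : Type*} [Primcodable α] [Primcodable β] [Primcodable γ] {O : Set (ℕ →. ℕ)}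

theorem ComputableIn.comp {g : β → γ} {f : α → β} (hg : ComputableIn O g) (hf : ComputableIn O f) :
    ComputableIn O fun a => g (f a) := by
  refine Nat.RecursiveIn.of_eq (Nat.RecursiveIn.comp hg hf) fun n => ?_
  cases h : (decode n : Option α) <;> simp [encodek]

theorem ComputableIn.pair {f : α → β} {g : α → γ} (hf : ComputableIn O f) (hg : ComputableIn O g) :
    ComputableIn O fun a => (f a, g a) := by
  refine Nat.RecursiveIn.of_eq (Nat.RecursiveIn.pair hf hg) fun n => ?_
  cases h : (decode n : Option α) <;> simp [Seq.seq, encode_prod_val]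

end ComputableIn

/-! ### Closure properties of the arithmetical hierarchy on sets of natural numbers -/

section IsSigma

variable {O : Set (ℕ →. ℕ)} {n : ℕ} {S T : Set ℕ}

theorem IsSigma.of_computableIn [DecidablePred (· ∈ S)]
    (h : ComputableIn O fun n => decide (n ∈ S)) : IsSigma O 0 S := by
  rw [IsSigma]; convert h

theorem IsSigma.compl (h : IsSigma O 0 S) : IsSigma O 0 Sᶜ := by
  classical
  rw [IsSigma] at h
  refine .of_computableIn ?_
  convert Primrec.not.computableIn.comp h using 2 with n
  by_cases hn : n ∈ S <;> simp [hn]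

theorem IsSigma.preimage {f : ℕ → ℕ} (hf : Computable f) (h : IsSigma O n S) :
    IsSigma O n (f ⁻¹' S) := by
  induction n generalizing S f with
  | zero => exact ComputableIn.comp h hf.computableIn
  | succ n ih =>
    obtain ⟨R, hR, rfl⟩ := h
    let g : ℕ → ℕ := fun x => Nat.pair (f x.unpair.1) x.unpair.2
    have hg : Computable g := (Primrec₂.natPair.to_comp).comp
      (hf.comp (Computable.fst.comp Computable.unpair)) (Computable.snd.comp Computable.unpair)
    refine ⟨g ⁻¹' R, ih hg hR, ?_⟩
    ext x
    simp [g]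

theorem IsSigma.succ_of_compl (h : IsSigma O n Sᶜ) : IsSigma O (n + 1) S := by
  refine ⟨(fun x => x.unpair.1) ⁻¹' S,
    h.preimage (f := fun x => x.unpair.1) (Computable.fst.comp Computable.unpair), ?_⟩
  ext x
  simp

/-- Only the bottom level needs an argument, namely that computable sets are closed under
complement; above it the same matrix serves at the next level. -/
theorem IsSigma.succ (h : IsSigma O n S) : IsSigma O (n + 1) S := by
  induction n generalizing S with
  | zero => exact h.compl.succ_of_compl
  | succ n ih =>
    obtain ⟨R, hR, rfl⟩ := h
    exact ⟨R, ih hR, rfl⟩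

/-- The two claims need a joint induction, because complementing the matrix exchanges union and
intersection. -/
theorem IsSigma.union_inter (hS : IsSigma O n S) (hT : IsSigma O n T) :
    IsSigma O n (S ∪ T) ∧ IsSigma O n (S ∩ T) := by
  classical
  induction n generalizing S T with
  | zero =>
    rw [IsSigma] at hS hT
    constructor
    · refine .of_computableIn ?_
      convert Primrec.or.computableIn₂.comp (hS.pair hT) using 2 with n
      by_cases h : n ∈ S <;> by_cases h' : n ∈ T <;> simp [h, h']
    · refine .of_computableIn ?_
      convert Primrec.and.computableIn₂.comp (hS.pair hT) using 2 with n
      by_cases h : n ∈ S <;> by_cases h' : n ∈ T <;> simp [h, h']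
  | succ n ih =>
    obtain ⟨R, hR, rfl⟩ := hS
    obtain ⟨Q, hQ, rfl⟩ := hT
    constructor
    · refine ⟨R ∪ Q, by rw [Set.compl_union]; exact (ih hR hQ).2, ?_⟩
      ext x
      simp [exists_or]
    · let g : ℕ → ℕ := fun x => Nat.pair x.unpair.1 x.unpair.2.unpair.1
      let h : ℕ → ℕ := fun x => Nat.pair x.unpair.1 x.unpair.2.unpair.2
      have hu : Computable Nat.unpair := Computable.unpair
      have hg : Computable g := (Primrec₂.natPair.to_comp).comp (Computable.fst.comp hu)
        (Computable.fst.comp (hu.comp (Computable.snd.comp hu)))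
      have hh : Computable h := (Primrec₂.natPair.to_comp).comp (Computable.fst.comp hu)
        (Computable.snd.comp (hu.comp (Computable.snd.comp hu)))
      refine ⟨g ⁻¹' R ∩ h ⁻¹' Q, ?_, ?_⟩
      · rw [Set.compl_inter]
        exact (ih (hR.preimage hg) (hQ.preimage hh)).1
      · ext x
        simp only [Set.mem_inter_iff, Set.mem_ofPred_eq, Set.mem_preimage, g, h]
        constructor
        · rintro ⟨⟨y, hy⟩, z, hz⟩
          exact ⟨Nat.pair y z, by simpa using ⟨hy, hz⟩⟩
        · rintro ⟨y, hy, hz⟩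
          exact ⟨⟨_, by simpa using hy⟩, _, by simpa using hz⟩

end IsSigma

/-! ### The arithmetical hierarchy for predicates on encodable types -/

/-- The predicate `p` is `Σ⁰ₙ(O)` on codes. -/
def SigmaPred {α : Type*} [Primcodable α] (O : Set (ℕ →. ℕ)) (n : ℕ) (p : α → Prop) : Prop :=
  ∃ S : Set ℕ, IsSigma O n S ∧ ∀ a, p a ↔ encode a ∈ S

attribute [fun_prop] Primrec

attribute [fun_prop] Primrec.const Primrec.pair Primrec.fst Primrec.snd Primrec.comp Primrec.id

namespace SigmaPred

variable {α β γ : Type*} [Primcodable α] [Primcodable β] [Primcodable γ]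
variable {O : Set (ℕ →. ℕ)} {n : ℕ} {p q : α → Prop}

theorem of_iff (h : SigmaPred O n p) (H : ∀ a, q a ↔ p a) : SigmaPred O n q := by
  rwa [show q = p from funext fun a => propext (H a)]

theorem comp {f : β → α} (h : SigmaPred O n p) (hf : Primrec f) :
    SigmaPred O n fun b => p (f b) := by
  obtain ⟨S, hS, H⟩ := h
  -- Numbers that code nothing go to `0`; this is harmless, as `SigmaPred` looks only at codes.
  have hg : Primrec fun m : ℕ => (((decode m : Option β).map fun b => encode (f b)).getD 0) :=
    Primrec.option_getD.comp (Primrec.option_map Primrec.decode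
      (Primrec.encode.comp (hf.comp Primrec.snd)).to₂) (Primrec.const 0)
  exact ⟨_, hS.preimage hg.to_comp, fun b => by simp [H, encodek]⟩

theorem and (hp : SigmaPred O n p) (hq : SigmaPred O n q) : SigmaPred O n fun a => p a ∧ q a := by
  obtain ⟨S, hS, hp⟩ := hp
  obtain ⟨T, hT, hq⟩ := hq
  exact ⟨_, (hS.union_inter hT).2, fun a => by simp [hp, hq]⟩

theorem or (hp : SigmaPred O n p) (hq : SigmaPred O n q) : SigmaPred O n fun a => p a ∨ q a := by
  obtain ⟨S, hS, hp⟩ := hp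
  obtain ⟨T, hT, hq⟩ := hq
  exact ⟨_, (hS.union_inter hT).1, fun a => by simp [hp, hq]⟩

theorem succ (hp : SigmaPred O n p) : SigmaPred O (n + 1) p := by
  obtain ⟨S, hS, hp⟩ := hp
  exact ⟨S, hS.succ, hp⟩

theorem succ_of_not (hp : SigmaPred O n fun a => ¬ p a) : SigmaPred O (n + 1) p := by
  obtain ⟨S, hS, hp⟩ := hp
  exact ⟨Sᶜ, IsSigma.succ_of_compl (by rwa [compl_compl]), fun a => by simp [← hp]⟩

theorem not_zero (hp : SigmaPred O 0 p) : SigmaPred O 0 fun a => ¬ p a := by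
  obtain ⟨S, hS, hp⟩ := hp
  exact ⟨Sᶜ, hS.compl, fun a => by simp [hp]⟩

theorem mono_of_zero (hp : SigmaPred O 0 p) : SigmaPred O n p := by
  induction n with
  | zero => exact hp
  | succ n ih => exact ih.succ

theorem of_primrecPred (hp : PrimrecPred p) : SigmaPred O n p := by
  obtain ⟨_, hp⟩ := hp
  have hg : Primrec fun m : ℕ => (((decode m : Option α).map fun b => decide (p b)).getD false) :=
    Primrec.option_getD.comp (Primrec.option_map Primrec.decode
      (hp.comp Primrec.snd).to₂) (Primrec.const false)
  refine mono_of_zero ⟨{m | ((decode m : Option α).map fun b => decide (p b)).getD false = true},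
    IsSigma.of_computableIn ?_, fun a => by simp [encodek]⟩
  exact hg.computableIn.of_eq fun m => by simp

theorem eq {f g : α → β} (hf : Primrec f) (hg : Primrec g) :
    SigmaPred O n fun a => f a = g a :=
  of_primrecPred (Primrec.eq.comp hf hg)

theorem ne {f g : α → β} (hf : Primrec f) (hg : Primrec g) :
    SigmaPred O n fun a => ¬ f a = g a :=
  of_primrecPred (Primrec.eq.comp hf hg).not

theorem lt {f g : α → ℕ} (hf : Primrec f) (hg : Primrec g) :
    SigmaPred O n fun a => f a < g a :=
  of_primrecPred (Primrec.nat_lt.comp hf hg)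

theorem exists_matrix (hp : SigmaPred O (n + 1) p) :
    ∃ r : α × ℕ → Prop, (SigmaPred O n fun x => ¬ r x) ∧ ∀ a, p a ↔ ∃ m, r (a, m) := by
  obtain ⟨S, ⟨R, hR, rfl⟩, hp⟩ := hp
  exact ⟨fun x => encode x ∈ R, ⟨Rᶜ, hR, fun _ => Iff.rfl⟩, fun a => by simp [hp]⟩

/-- Decoding with a default value maps `ℕ` onto `β`, so a quantifier over `β` is a number
quantifier. -/
theorem exists_of_not [Inhabited β] {r : α × β → Prop} (hr : SigmaPred O n fun x => ¬ r x) :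
    SigmaPred O (n + 1) fun a => ∃ b, r (a, b) := by
  have hd : Primrec fun x : α × ℕ => (x.1, (decode x.2 : Option β).getD default) :=
    Primrec.fst.pair (Primrec.option_getD.comp (Primrec.decode.comp Primrec.snd) (Primrec.const _))
  obtain ⟨S, hS, H⟩ := hr.comp hd
  refine ⟨{x | ∃ y, Nat.pair x y ∈ Sᶜ}, ⟨Sᶜ, by rwa [compl_compl], rfl⟩, fun a => ?_⟩
  have H' : ∀ y, Nat.pair (encode a) y ∈ Sᶜ ↔ r (a, (decode y : Option β).getD default) :=
    fun y => by
      have := H (a, y)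
      rw [encode_prod_val, encode_nat] at this
      rw [Set.mem_compl_iff, ← this, not_not]
  simp only [Set.mem_ofPred_eq, H']
  exact ⟨fun ⟨b, hb⟩ => ⟨encode b, by simpa [encodek] using hb⟩, fun ⟨_, hy⟩ => ⟨_, hy⟩⟩

theorem ex [Inhabited β] {r : α → β → Prop}
    (hr : SigmaPred O (n + 1) fun x : α × β => r x.1 x.2) :
    SigmaPred O (n + 1) fun a => ∃ b, r a b := by
  obtain ⟨t, ht, H⟩ := hr.exists_matrix
  refine (exists_of_not (r := fun x : α × β × ℕ => t ((x.1, x.2.1), x.2.2))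
    (ht.comp (by fun_prop))).of_iff fun a => ?_
  simp only [Prod.exists]
  exact exists_congr fun b => H (a, b)

theorem not_forall [Inhabited β] {r : α → β → Prop}
    (hr : SigmaPred O (n + 1) fun x : α × β => ¬ r x.1 x.2) :
    SigmaPred O (n + 1) fun a => ¬ ∀ b, r a b :=
  (ex (r := fun a b => ¬ r a b) hr).of_iff fun _ => by simp

end SigmaPred

section Primrec

variable {α β : Type*} [Primcodable α] [Primcodable β]

@[fun_prop]
theorem Primrec.getElem?_comp {f : α → List β} {g : α → ℕ} (hf : Primrec f) (hg : Primrec g) :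
    Primrec fun a => (f a)[g a]? :=
  Primrec.list_getElem?.comp hf hg

@[fun_prop]
theorem Primrec.getD_comp {f : α → List β} {g : α → ℕ} {d : β} (hf : Primrec f) (hg : Primrec g) :
    Primrec fun a => (f a).getD (g a) d :=
  (Primrec.list_getD d).comp hf hg

@[fun_prop]
theorem Primrec.some_comp {f : α → β} (hf : Primrec f) : Primrec fun a => some (f a) :=
  Primrec.option_some.comp hf

@[fun_prop]
theorem Primrec.add_one_comp {f : α → ℕ} (hf : Primrec f) : Primrec fun a => f a + 1 :=
  Primrec.succ.comp hf

end Primrec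

/-! ### Bounded quantifiers and definition by recursion -/

namespace SigmaPred

variable {α β γ : Type*} [Primcodable α] [Primcodable β] [Primcodable γ]
variable {O : Set (ℕ →. ℕ)} {n : ℕ}

/-- The witnesses for all `i < g a` are collected in one list. The bounded quantifier then stands
inside the matrix, where it is read as an unbounded one and absorbed by the Π level `n + 1`; this is
why the level starts at 2. -/
theorem forall_lt {p : α → ℕ → Prop} {g : α → ℕ} (hg : Primrec g)
    (hp : SigmaPred O (n + 2) fun x : α × ℕ => p x.1 x.2) :
    SigmaPred O (n + 2) fun a => ∀ i < g a, p a i := by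
  obtain ⟨r, hr, H⟩ := hp.exists_matrix
  have H : ∀ a i, p a i ↔ ∃ m, r ((a, i), m) := fun a i => H (a, i)
  have key : SigmaPred O (n + 2) fun a => ∃ w : List ℕ, ∀ i, i < g a → r ((a, i), w.getD i 0) := by
    refine exists_of_not (r := fun x : α × List ℕ => ∀ i, i < g x.1 → r ((x.1, i), x.2.getD i 0))
      (not_forall ?_)
    refine ((lt (f := fun x : (α × List ℕ) × ℕ => x.2) (g := fun x => g x.1.1)
      (by fun_prop) (by fun_prop)).and (hr.comp
        (f := fun x : (α × List ℕ) × ℕ => ((x.1.1, x.2), x.1.2.getD x.2 0))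
        (by fun_prop))).of_iff fun x => by simp
  refine key.of_iff fun a => ⟨fun h => ?_, fun ⟨w, hw⟩ i hi => (H a i).2 ⟨_, hw i hi⟩⟩
  have h' : ∀ i, ∃ m, i < g a → r ((a, i), m) := fun i => by
    by_cases hi : i < g a
    · obtain ⟨m, hm⟩ := (H a i).1 (h i hi)
      exact ⟨m, fun _ => hm⟩
    · exact ⟨0, fun h => absurd h hi⟩
  choose m hm using h'
  refine ⟨(List.range (g a)).map m, fun i hi => ?_⟩
  have : ((List.range (g a)).map m).getD i 0 = m i := by simp [List.getD, hi]
  rw [this]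
  exact hm i hi

/-- A sequence which is defined by recursion has a `Σ⁰ₙ` graph if its step relation is `Σ⁰ₙ`. -/
theorem graph_of_step [Inhabited β] {F : α → ℕ → β} {R : α → ℕ → β → β → Prop}
    (h0 : Primrec fun a => F a 0)
    (hR : SigmaPred O (n + 2) fun x : α × ℕ × β × β => R x.1 x.2.1 x.2.2.1 x.2.2.2)
    (H : ∀ a i c, R a i (F a i) c ↔ c = F a (i + 1)) :
    SigmaPred O (n + 2) fun x : α × ℕ × β => F x.1 x.2.1 = x.2.2 := by
  -- The witness is the list of values up to the index in question. `H` determines the step only at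
  -- true values, which suffices because the list is checked upwards from `F a 0`.
  have key : SigmaPred O (n + 2) fun x : α × ℕ × β => ∃ w : List β,
      w.getD 0 default = F x.1 0 ∧ w.getD x.2.1 default = x.2.2 ∧
        ∀ i < x.2.1, R x.1 i (w.getD i default) (w.getD (i + 1) default) := by
    refine ex ((eq (by fun_prop) (by fun_prop)).and ((eq (by fun_prop) (by fun_prop)).and
      (forall_lt (by fun_prop) ?_)))
    exact hR.comp (f := fun x : ((α × ℕ × β) × List β) × ℕ =>
      (x.1.1.1, x.2, x.1.2.getD x.2 default, x.1.2.getD (x.2 + 1) default)) (by fun_prop)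
  refine key.of_iff fun ⟨a, k, b⟩ => ⟨?_, ?_⟩
  · rintro (rfl : F a k = b)
    have hw : ∀ i ≤ k, ((List.range (k + 1)).map (F a)).getD i default = F a i := fun i hi => by
      simp [List.getD, Nat.lt_succ_of_le hi]
    refine ⟨(List.range (k + 1)).map (F a), hw 0 k.zero_le, hw k le_rfl, fun i hi => ?_⟩
    rw [hw i hi.le, hw (i + 1) hi, H]
  · rintro ⟨w, hw0, hwk, hw⟩
    have : ∀ i ≤ k, w.getD i default = F a i := fun i => by
      induction i with
      | zero => exact fun _ => hw0
      | succ i ih => exact fun hi => (H a i _).1 (ih (by omega) ▸ hw i hi)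
    exact (this k le_rfl).symm.trans hwk

/-- The fold is the recursion over prefixes of the list, which stays constant beyond its end. -/
theorem graph_foldl [Inhabited β] [Inhabited γ] {f : β → γ → β}
    (hf : SigmaPred O (n + 2) fun x : (β × γ) × β => f x.1.1 x.1.2 = x.2) :
    SigmaPred O (n + 2) fun x : (List γ × β) × β => x.1.1.foldl f x.1.2 = x.2 := by
  have key : SigmaPred O (n + 2) fun x : (List γ × β) × ℕ × β =>
      (x.1.1.take x.2.1).foldl f x.1.2 = x.2.2 := by
    refine graph_of_step (F := fun (a : List γ × β) i => (a.1.take i).foldl f a.2)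
      (R := fun a i b c => (a.1[i]? = none ∧ b = c) ∨
        ∃ d, a.1[i]? = some d ∧ f b d = c) (by simpa using Primrec.snd) ?_ ?_
    · refine ((eq (by fun_prop) (by fun_prop)).and (eq (by fun_prop) (by fun_prop))).or
        (ex ((eq (by fun_prop) (by fun_prop)).and ?_))
      exact hf.comp (f := fun x : ((List γ × β) × ℕ × β × β) × γ => ((x.1.2.2.1, x.2), x.1.2.2.2))
        (by fun_prop)
    · rintro ⟨w, b⟩ i c
      simp only [List.take_add_one, List.foldl_append]
      cases w[i]? <;> simp [eq_comm]
  refine (key.comp (f := fun x : (List γ × β) × β => (x.1, x.1.1.length, x.2)) ?_).of_iff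
    fun x => by simp
  exact Primrec.fst.pair ((Primrec.list_length.comp (by fun_prop)).pair (by fun_prop))

end SigmaPred

/-! ### Words in successor and predecessor, and matchings which preserve them -/

section LinearOrder

variable {L M N : Type*} [LinearOrder L] [LinearOrder M] [LinearOrder N]

/-- Covers are unique, so the choice in `spSucc` is immaterial. Both invariance under isomorphisms
and the complexity bound rest on this description. -/
theorem spSucc_eq_iff {x y : M} : spSucc x = y ↔ x ⋖ y ∨ (y = x ∧ ∀ z, ¬ x ⋖ z) := by
  unfold spSucc
  split_ifs with h
  · refine ⟨fun hy => Or.inl (hy ▸ h.choose_spec), ?_⟩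
    rintro (hy | hy)
    · exact h.choose_spec.unique_right hy
    · exact absurd h.choose_spec (hy.2 _)
  · push Not at h
    simp [h, eq_comm]

theorem spPred_eq_iff {x y : M} : spPred x = y ↔ y ⋖ x ∨ (y = x ∧ ∀ z, ¬ z ⋖ x) := by
  unfold spPred
  split_ifs with h
  · refine ⟨fun hy => Or.inl (hy ▸ h.choose_spec), ?_⟩
    rintro (hy | hy)
    · exact h.choose_spec.unique_left hy
    · exact absurd h.choose_spec (hy.2 _)
  · push Not at h
    simp [h, eq_comm]

theorem OrderIso.map_spSucc (e : M ≃o N) (x : M) : e (spSucc x) = spSucc (e x) := by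
  symm
  rw [spSucc_eq_iff, e.surjective.forall]
  simpa only [apply_covBy_apply_iff, EmbeddingLike.apply_eq_iff_eq] using spSucc_eq_iff.1 rfl

theorem OrderIso.map_spPred (e : M ≃o N) (x : M) : e (spPred x) = spPred (e x) := by
  symm
  rw [spPred_eq_iff, e.surjective.forall]
  simpa only [apply_covBy_apply_iff, EmbeddingLike.apply_eq_iff_eq] using spPred_eq_iff.1 rfl

/-- The letter `0` acts as the successor function, every other letter as the predecessor. -/
noncomputable def spStep (x : M) (c : ℕ) : M := if c = 0 then spSucc x else spPred x

/-- The action of a word in the successor and predecessor functions. -/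
noncomputable def spAct (w : List ℕ) (x : M) : M := w.foldl spStep x

theorem OrderIso.map_spAct (e : M ≃o N) (w : List ℕ) (x : M) :
    e (spAct w x) = spAct w (e x) := by
  induction w generalizing x with
  | nil => rfl
  | cons c w ih =>
    have : e (spStep x c) = spStep (e x) c := by
      unfold spStep
      split_ifs
      exacts [e.map_spSucc x, e.map_spPred x]
    exact (ih _).trans (by rw [this]; rfl)

theorem spAct_append_singleton (w : List ℕ) (c : ℕ) (x : M) :
    spAct (w ++ [c]) x = spStep (spAct w x) c := by
  simp [spAct]

/-- A set of pairs is a matching if its two sides satisfy the same atomic formulas in the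
language of sp-linear orderings. -/
def IsSPMatching (σ : Set (M × N)) : Prop :=
  ∀ a ∈ σ, ∀ b ∈ σ, ∀ v w : List ℕ, spAct v a.1 ≤ spAct w b.1 ↔ spAct v a.2 ≤ spAct w b.2

theorem IsSPMatching.of_orderIso {σ : Set (M × N)} (e : M ≃o N) (h : ∀ a ∈ σ, e a.1 = a.2) :
    IsSPMatching σ := fun _ ha _ hb v w => by
  rw [← h _ ha, ← h _ hb, ← e.map_spAct, ← e.map_spAct, e.le_iff_le]

theorem IsSPMatching.eq_iff {σ : Set (M × N)} (h : IsSPMatching σ) {a b : M × N} (ha : a ∈ σ)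
    (hb : b ∈ σ) (v w : List ℕ) : spAct v a.1 = spAct w b.1 ↔ spAct v a.2 = spAct w b.2 := by
  rw [le_antisymm_iff, h a ha b hb, h b hb a ha, ← le_antisymm_iff]

/-- All function symbols are unary, so each generated element comes from a single generator. -/
theorem mem_closure_iff_exists_spAct (s : Set L) (x : L) :
    letI := spStructure L
    x ∈ Language.Substructure.closure spLanguage s ↔ ∃ w, ∃ a ∈ s, spAct w a = x := by
  let := spStructure L
  constructor
  · intro hx
    refine Language.Substructure.closure_induction hx (fun a ha => ⟨[], a, ha, rfl⟩) ?_
    intro n f v hv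
    cases f with
    | s =>
      obtain ⟨w, a, ha, h⟩ := hv 0
      refine ⟨w ++ [0], a, ha, ?_⟩
      rw [spAct_append_singleton, h]
      rfl
    | p =>
      obtain ⟨w, a, ha, h⟩ := hv 0
      refine ⟨w ++ [1], a, ha, ?_⟩
      rw [spAct_append_singleton, h]
      rfl
  · rintro ⟨w, a, ha, rfl⟩
    induction w using List.reverseRecOn with
    | nil => exact Language.Substructure.subset_closure ha
    | append_singleton w c ih =>
      rw [spAct_append_singleton, spStep]
      split_ifs
      · exact Language.Substructure.fun_mem _ (SPFunc.s : spLanguage.Functions 1)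
          (fun _ => spAct w a) fun _ => ih
      · exact Language.Substructure.fun_mem _ (SPFunc.p : spLanguage.Functions 1)
          (fun _ => spAct w a) fun _ => ih

/-- The isomorphism of generated substructures which is induced by a matching. -/
theorem IsSPMatching.exists_equiv {σ : Set (L × L)} (h : IsSPMatching σ) :
    letI := spStructure L
    ∃ f : Language.Substructure.closure spLanguage (Prod.fst '' σ) ≃[spLanguage]
      Language.Substructure.closure spLanguage (Prod.snd '' σ),
        ∀ a ∈ σ, ∀ ha, (f ⟨a.1, ha⟩ : L) = a.2 := by
  let := spStructure L
  have hS : ∀ x : Language.Substructure.closure spLanguage (Prod.fst '' σ),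
      ∃ w, ∃ a ∈ σ, spAct w a.1 = x := fun x => by
    obtain ⟨w, _, ⟨a, ha, rfl⟩, hw⟩ := (mem_closure_iff_exists_spAct _ _).1 x.2
    exact ⟨w, a, ha, hw⟩
  choose w a ha hw using hS
  let f : Language.Substructure.closure spLanguage (Prod.fst '' σ) →
      Language.Substructure.closure spLanguage (Prod.snd '' σ) := fun x =>
    ⟨spAct (w x) (a x).2, (mem_closure_iff_exists_spAct _ _).2 ⟨_, _, ⟨_, ha x, rfl⟩, rfl⟩⟩
  -- The value of `f` does not depend on the chosen word and generator, as matchings preserve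
  -- equalities between terms.
  have hf : ∀ (x : Language.Substructure.closure spLanguage (Prod.fst '' σ)), ∀ b ∈ σ, ∀ v,
      spAct v b.1 = x → (f x : L) = spAct v b.2 := fun x b hb v hv =>
    (h.eq_iff (ha x) hb _ _).1 ((hw x).trans hv.symm)
  have hstep : ∀ (x y : Language.Substructure.closure spLanguage (Prod.fst '' σ)) (c : ℕ),
      (y : L) = spStep (x : L) c → (f y : L) = spStep (f x : L) c := fun x y c hy => by
    rw [hf y (a x) (ha x) (w x ++ [c]) (by rw [spAct_append_singleton, hw, hy]),
      spAct_append_singleton]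
  have hinj : Function.Injective f := fun x y hxy => by
    have := (h.eq_iff (ha x) (ha y) (w x) (w y)).2 (congrArg Subtype.val hxy)
    rw [hw, hw] at this
    exact Subtype.ext this
  have hsurj : Function.Surjective f := fun y => by
    obtain ⟨v, _, ⟨b, hb, rfl⟩, hv⟩ := (mem_closure_iff_exists_spAct _ _).1 y.2
    refine ⟨⟨spAct v b.1, (mem_closure_iff_exists_spAct _ _).2 ⟨_, _, ⟨b, hb, rfl⟩, rfl⟩⟩, ?_⟩
    exact Subtype.ext ((hf _ b hb v rfl).trans hv)
  refine ⟨⟨Equiv.ofBijective f ⟨hinj, hsurj⟩, ?_, ?_⟩, fun b hb _ => hf _ b hb [] rfl⟩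
  · intro n g v
    cases g with
    | s => exact Subtype.ext (hstep (v 0) _ 0 rfl)
    | p => exact Subtype.ext (hstep (v 0) _ 1 rfl)
  · intro n r v
    cases r with
    | le =>
      change (f (v 0) : L) ≤ f (v 1) ↔ (v 0 : L) ≤ v 1
      rw [← hw (v 0), ← hw (v 1)]
      exact (h _ (ha _) _ (ha _) _ _).symm

/-- In a weakly homogeneous sp-ordering, finite matchings which fix the exceptional elements
extend to automorphisms of the ordering. -/
theorem WeaklySPHomogeneous.exists_orderIso (hL : WeaklySPHomogeneous L) :
    ∃ E : Finset L, ∀ σ : Set (L × L), σ.Finite → IsSPMatching σ → (∀ x ∈ E, (x, x) ∈ σ) →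
      ∃ g : L ≃o L, ∀ a ∈ σ, g a.1 = a.2 := by
  let := spStructure L
  obtain ⟨E, hE⟩ := hL
  refine ⟨E, fun σ hσ h hEσ => ?_⟩
  obtain ⟨f, hf⟩ := h.exists_equiv
  have hmem : ∀ a ∈ σ, a.1 ∈ Language.Substructure.closure spLanguage (Prod.fst '' σ) :=
    fun a ha => Language.Substructure.subset_closure ⟨a, ha, rfl⟩
  obtain ⟨g, hg⟩ := hE _ _ (Language.Substructure.fg_closure (hσ.image _))
    (Language.Substructure.fg_closure (hσ.image _)) f
    fun x hx => ⟨hmem _ (hEσ x hx), hf _ (hEσ x hx) _⟩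
  refine ⟨⟨g.toEquiv, fun {x y} => ?_⟩, fun a ha => ?_⟩
  · exact g.map_rel (Language.orderRel.le : spLanguage.Relations 2) ![x, y]
  · exact (hg ⟨a.1, hmem a ha⟩).trans (hf a ha _)

/-- The back-and-forth property of finite matchings between copies of a weakly homogeneous
sp-ordering. -/
theorem WeaklySPHomogeneous.exists_insert (hL : WeaklySPHomogeneous L) (e : L ≃o M)
    (e' : L ≃o N) : ∃ σ₀ : Set (M × N), σ₀.Finite ∧ IsSPMatching σ₀ ∧
      ∀ σ : Set (M × N), σ.Finite → IsSPMatching σ → σ₀ ⊆ σ →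
        (∀ x, ∃ y, IsSPMatching (insert (x, y) σ)) ∧
          ∀ y, ∃ x, IsSPMatching (insert (x, y) σ) := by
  obtain ⟨E, hE⟩ := hL.exists_orderIso
  refine ⟨(fun x => (e x, e' x)) '' E, E.finite_toSet.image _, ?_, fun σ hσ h hsub => ?_⟩
  · refine .of_orderIso (e.symm.trans e') ?_
    rintro _ ⟨x, -, rfl⟩
    simp
  -- Pulled back along `e` and `e'`, `σ` is a matching of `L` with itself that contains the diagonal
  -- of `E`. The extending automorphism yields an isomorphism `k` through `σ`, and `k` supplies the
  -- partners on both sides.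
  · obtain ⟨g, hg⟩ := hE ((fun a => (e.symm a.1, e'.symm a.2)) '' σ) (hσ.image _) (by
      rintro _ ⟨a, ha, rfl⟩ _ ⟨b, hb, rfl⟩ v w
      simp only [← OrderIso.map_spAct, OrderIso.le_iff_le]
      exact h a ha b hb v w) fun x hx => ⟨_, hsub ⟨x, hx, rfl⟩, by simp⟩
    let k : M ≃o N := (e.symm.trans g).trans e'
    have hk : ∀ a ∈ σ, k a.1 = a.2 := fun a ha => by
      have := hg _ ⟨a, ha, rfl⟩
      simp only at this
      simp [k, this]
    refine ⟨fun x => ⟨k x, .of_orderIso k ?_⟩, fun y => ⟨k.symm y, .of_orderIso k ?_⟩⟩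
    · rintro a (rfl | ha)
      exacts [rfl, hk a ha]
    · rintro a (rfl | ha)
      exacts [k.apply_symm_apply y, hk a ha]

end LinearOrder

/-! ### Arithmetical definability over presentations -/

theorem SigmaPred.comp_graph {α β : Type*} [Primcodable α] [Primcodable β] [Inhabited β]
    {O : Set (ℕ →. ℕ)} {n : ℕ} {f : α → β} {q : α → β → Prop}
    (hf : SigmaPred O (n + 1) fun x : α × β => f x.1 = x.2)
    (hq : SigmaPred O (n + 1) fun x : α × β => q x.1 x.2) :
    SigmaPred O (n + 1) fun a => q a (f a) :=
  (SigmaPred.ex (r := fun a b => f a = b ∧ q a b) (hf.and hq)).of_iff fun a => by simp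

namespace OrderPresentation

section Presentation

variable (P : OrderPresentation)

theorem Elem.toNat_injective : Function.Injective (Elem.toNat : P.Elem → ℕ) :=
  Subtype.val_injective

/-- The order of a presentation as a relation on the natural numbers. -/
def NatLe (x y : ℕ) : Prop := ∃ a b : P.Elem, a.toNat = x ∧ b.toNat = y ∧ a ≤ b

theorem diagram_pair_eq_one_iff (x y : ℕ) : P.diagram (Nat.pair x y) = 1 ↔ P.NatLe x y := by
  simp [diagram, NatLe, Nat.pair_eq_pair, and_assoc, eq_comm]

variable {P}

@[simp]
theorem natLe_toNat {a b : P.Elem} : P.NatLe a.toNat b.toNat ↔ a ≤ b := by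
  simp [NatLe, (Elem.toNat_injective P).eq_iff]

theorem NatLe.exists_left {x y : ℕ} (h : P.NatLe x y) : ∃ a : P.Elem, a.toNat = x := by
  obtain ⟨a, -, h, -⟩ := h
  exact ⟨a, h⟩

theorem NatLe.exists_right {x y : ℕ} (h : P.NatLe x y) : ∃ a : P.Elem, a.toNat = y := by
  obtain ⟨-, a, -, h, -⟩ := h
  exact ⟨a, h⟩

theorem natLe_self_iff {x : ℕ} : P.NatLe x x ↔ ∃ a : P.Elem, a.toNat = x :=
  ⟨fun h => h.exists_left, by rintro ⟨a, rfl⟩; simp⟩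

variable (P)

/-- The covering relation of a presentation as a relation on the natural numbers. -/
def NatCovBy (x y : ℕ) : Prop :=
  (P.NatLe x y ∧ ¬ P.NatLe y x) ∧
    ∀ z, ¬ ((P.NatLe x z ∧ ¬ P.NatLe z x) ∧ (P.NatLe z y ∧ ¬ P.NatLe y z))

variable {P}

@[simp]
theorem natCovBy_toNat {a b : P.Elem} : P.NatCovBy a.toNat b.toNat ↔ a ⋖ b := by
  constructor
  · rintro ⟨h, h'⟩
    refine ⟨by simpa using h.2, fun c hac hcb => h' c.toNat ?_⟩
    simpa using ⟨⟨hac.le, hac⟩, hcb.le, hcb⟩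
  · intro h
    refine ⟨by simpa using ⟨h.le, h.lt⟩, ?_⟩
    rintro z ⟨⟨hz, hz'⟩, hz'', hz'''⟩
    obtain ⟨c, rfl⟩ := hz.exists_right
    simp only [natLe_toNat, not_le] at hz' hz'''
    exact h.2 hz' hz'''

theorem natCovBy_toNat_left {a : P.Elem} {y : ℕ} :
    P.NatCovBy a.toNat y ↔ ∃ b : P.Elem, b.toNat = y ∧ a ⋖ b := by
  constructor
  · intro h
    obtain ⟨b, rfl⟩ := h.1.1.exists_right
    exact ⟨b, rfl, natCovBy_toNat.1 h⟩
  · rintro ⟨b, rfl, h⟩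
    exact natCovBy_toNat.2 h

theorem natCovBy_toNat_right {a : P.Elem} {y : ℕ} :
    P.NatCovBy y a.toNat ↔ ∃ b : P.Elem, b.toNat = y ∧ b ⋖ a := by
  constructor
  · intro h
    obtain ⟨b, rfl⟩ := h.1.1.exists_left
    exact ⟨b, rfl, natCovBy_toNat.1 h⟩
  · rintro ⟨b, rfl, h⟩
    exact natCovBy_toNat.2 h

variable (P)

open Classical in
/-- The step function on natural numbers, which is the identity outside of the universe. -/
noncomputable def natStep (x c : ℕ) : ℕ :=
  if h : ∃ a : P.Elem, a.toNat = x then (spStep h.choose c).toNat else x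

variable {P}

theorem natStep_toNat (a : P.Elem) (c : ℕ) : P.natStep a.toNat c = (spStep a c).toNat := by
  have h : ∃ b : P.Elem, b.toNat = a.toNat := ⟨a, rfl⟩
  rw [natStep, dif_pos h, Elem.toNat_injective P h.choose_spec]

theorem foldl_natStep_toNat (w : List ℕ) (a : P.Elem) :
    w.foldl P.natStep a.toNat = (spAct w a).toNat := by
  induction w generalizing a with
  | nil => rfl
  | cons c w ih => rw [List.foldl_cons, natStep_toNat, ih]; rfl

/-- This form mentions only the order and covering relations, so the complexity can be read off. -/
theorem natStep_eq_iff (x c y : ℕ) : P.natStep x c = y ↔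
    (¬ P.NatLe x x ∧ x = y) ∨ (P.NatLe x x ∧
      ((c = 0 ∧ (P.NatCovBy x y ∨ (y = x ∧ ¬ ∃ z, P.NatCovBy x z))) ∨
        (¬ c = 0 ∧ (P.NatCovBy y x ∨ (y = x ∧ ¬ ∃ z, P.NatCovBy z x))))) := by
  rw [natLe_self_iff]
  by_cases hx : ∃ a : P.Elem, a.toNat = x
  · obtain ⟨a, rfl⟩ := hx
    rw [natStep_toNat]
    have h1 : (∃ z, P.NatCovBy a.toNat z) ↔ ∃ b, a ⋖ b := by
      simp only [natCovBy_toNat_left]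
      exact ⟨fun ⟨_, b, _, h⟩ => ⟨b, h⟩, fun ⟨b, h⟩ => ⟨_, b, rfl, h⟩⟩
    have h2 : (∃ z, P.NatCovBy z a.toNat) ↔ ∃ b, b ⋖ a := by
      simp only [natCovBy_toNat_right]
      exact ⟨fun ⟨_, b, _, h⟩ => ⟨b, h⟩, fun ⟨b, h⟩ => ⟨_, b, rfl, h⟩⟩
    rw [h1, h2]
    by_cases hy : ∃ b : P.Elem, b.toNat = y
    · obtain ⟨b, rfl⟩ := hy
      by_cases hc : c = 0 <;>
        simp [spStep, hc, spSucc_eq_iff, spPred_eq_iff, (Elem.toNat_injective P).eq_iff]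
    · have hya : y ≠ a.toNat := fun h => hy ⟨a, h.symm⟩
      have hl : ¬ P.NatCovBy a.toNat y := fun h => hy h.1.1.exists_right
      have hr : ¬ P.NatCovBy y a.toNat := fun h => hy h.1.1.exists_left
      simp [hya, hl, hr, show (spStep a c).toNat ≠ y from fun h => hy ⟨_, h⟩]
  · rw [natStep, dif_neg hx]
    simp [hx]

end Presentation

/-! ### Complexity of the order, of covering and of terms -/

section Definability

variable {P Q : OrderPresentation} {O : Set (ℕ →. ℕ)} {n : ℕ} {α : Type*} [Primcodable α]

theorem sigmaPred_zero_natLe (hP : (P.diagram : ℕ →. ℕ) ∈ O) :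
    SigmaPred O 0 fun x : ℕ × ℕ => P.NatLe x.1 x.2 := by
  refine ⟨{m | P.diagram m = 1}, .of_computableIn (ComputableIn.comp
    (g := fun k => decide (k = 1)) ?_ (RecursiveIn.oracle _ hP)), fun x => ?_⟩
  · exact (Primrec.eq.comp Primrec.id (Primrec.const 1)).decide.computableIn
  · exact (diagram_pair_eq_one_iff P x.1 x.2).symm

theorem sigmaPred_natLe (hP : (P.diagram : ℕ →. ℕ) ∈ O) {f g : α → ℕ} (hf : Primrec f)
    (hg : Primrec g) : SigmaPred O n fun x => P.NatLe (f x) (g x) :=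
  ((sigmaPred_zero_natLe hP).comp (hf.pair hg)).mono_of_zero

theorem sigmaPred_not_natLe (hP : (P.diagram : ℕ →. ℕ) ∈ O) {f g : α → ℕ} (hf : Primrec f)
    (hg : Primrec g) : SigmaPred O n fun x => ¬ P.NatLe (f x) (g x) :=
  ((sigmaPred_zero_natLe hP).comp (hf.pair hg)).not_zero.mono_of_zero

theorem sigmaPred_not_natCovBy (hP : (P.diagram : ℕ →. ℕ) ∈ O) :
    SigmaPred O 1 fun x : ℕ × ℕ => ¬ P.NatCovBy x.1 x.2 := by
  have h := SigmaPred.ex (O := O) (n := 0) (α := ℕ × ℕ) (β := ℕ) (r := fun x z =>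
    (P.NatLe x.1 z ∧ ¬ P.NatLe z x.1) ∧ (P.NatLe z x.2 ∧ ¬ P.NatLe x.2 z))
    (((sigmaPred_natLe hP (by fun_prop) (by fun_prop)).and
      (sigmaPred_not_natLe hP (by fun_prop) (by fun_prop))).and
    ((sigmaPred_natLe hP (by fun_prop) (by fun_prop)).and
      (sigmaPred_not_natLe hP (by fun_prop) (by fun_prop))))
  refine (((sigmaPred_not_natLe (f := fun x : ℕ × ℕ => x.1) (g := fun x => x.2) hP
    (by fun_prop) (by fun_prop)).or (sigmaPred_natLe hP (f := fun x : ℕ × ℕ => x.2)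
      (g := fun x => x.1) (by fun_prop) (by fun_prop))).or h).of_iff fun x => ?_
  rw [NatCovBy, not_and_or, not_and_or, not_not, not_forall]
  simp only [not_not]

theorem sigmaPred_natCovBy (hP : (P.diagram : ℕ →. ℕ) ∈ O) {f g : α → ℕ} (hf : Primrec f)
    (hg : Primrec g) : SigmaPred O 2 fun x => P.NatCovBy (f x) (g x) :=
  ((sigmaPred_not_natCovBy hP).succ_of_not).comp (hf.pair hg)

/-- The costly clause is the absence of a cover: it negates a Σ₂ statement, hence is Π₂ and so Σ₃.
-/
theorem sigmaPred_natStep (hP : (P.diagram : ℕ →. ℕ) ∈ O) :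
    SigmaPred O 3 fun x : (ℕ × ℕ) × ℕ => P.natStep x.1.1 x.1.2 = x.2 := by
  have h1 : SigmaPred O 3 fun x : (ℕ × ℕ) × ℕ => ¬ ∃ z, P.NatCovBy x.1.1 z :=
    .succ_of_not <| (SigmaPred.ex (r := fun (x : (ℕ × ℕ) × ℕ) z => P.NatCovBy x.1.1 z)
      (sigmaPred_natCovBy hP (by fun_prop) (by fun_prop))).of_iff fun _ => not_not
  have h2 : SigmaPred O 3 fun x : (ℕ × ℕ) × ℕ => ¬ ∃ z, P.NatCovBy z x.1.1 :=
    .succ_of_not <| (SigmaPred.ex (r := fun (x : (ℕ × ℕ) × ℕ) z => P.NatCovBy z x.1.1)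
      (sigmaPred_natCovBy hP (by fun_prop) (by fun_prop))).of_iff fun _ => not_not
  simp only [natStep_eq_iff]
  refine .or (.and (sigmaPred_not_natLe hP ?_ ?_) (.eq ?_ ?_))
    (.and (sigmaPred_natLe hP ?_ ?_) (.or
      (.and (.eq ?_ ?_) (.or (sigmaPred_natCovBy hP ?_ ?_).succ (.and (.eq ?_ ?_) h1)))
      (.and (.ne ?_ ?_) (.or (sigmaPred_natCovBy hP ?_ ?_).succ (.and (.eq ?_ ?_) h2)))))
  all_goals fun_prop

theorem sigmaPred_act (hP : (P.diagram : ℕ →. ℕ) ∈ O) {f : α → List ℕ} {g h : α → ℕ}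
    (hf : Primrec f) (hg : Primrec g) (hh : Primrec h) :
    SigmaPred O 3 fun x => (f x).foldl P.natStep (g x) = h x :=
  (SigmaPred.graph_foldl (sigmaPred_natStep hP)).comp ((hf.pair hg).pair hh)

/-- Term values are total functions with Σ₃ graphs. Guessing the values puts the inequality and its
negation both in Σ₃, so it is Δ₃. -/
theorem sigmaPred_natLe_act (hP : (P.diagram : ℕ →. ℕ) ∈ O) :
    (SigmaPred O 3 fun x : (List ℕ × List ℕ) × ℕ × ℕ =>
      P.NatLe (x.1.1.foldl P.natStep x.2.1) (x.1.2.foldl P.natStep x.2.2)) ∧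
    SigmaPred O 3 fun x : (List ℕ × List ℕ) × ℕ × ℕ =>
      ¬ P.NatLe (x.1.1.foldl P.natStep x.2.1) (x.1.2.foldl P.natStep x.2.2) := by
  have h : SigmaPred O 3 fun x : ((List ℕ × List ℕ) × ℕ × ℕ) × ℕ × ℕ =>
      (x.1.1.1.foldl P.natStep x.1.2.1, x.1.1.2.foldl P.natStep x.1.2.2) = x.2 :=
    ((sigmaPred_act (f := fun x : ((List ℕ × List ℕ) × ℕ × ℕ) × ℕ × ℕ => x.1.1.1)
      (g := fun x => x.1.2.1) (h := fun x => x.2.1) hP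
        (by fun_prop) (by fun_prop) (by fun_prop)).and
      (sigmaPred_act (f := fun x : ((List ℕ × List ℕ) × ℕ × ℕ) × ℕ × ℕ => x.1.1.2)
        (g := fun x => x.1.2.2) (h := fun x => x.2.2) hP
        (by fun_prop) (by fun_prop) (by fun_prop))).of_iff fun x => Prod.ext_iff
  have hf : Primrec fun x : ((List ℕ × List ℕ) × ℕ × ℕ) × ℕ × ℕ => x.2.1 := by fun_prop
  have hg : Primrec fun x : ((List ℕ × List ℕ) × ℕ × ℕ) × ℕ × ℕ => x.2.2 := by fun_prop
  exact ⟨SigmaPred.comp_graph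
      (f := fun x : (List ℕ × List ℕ) × ℕ × ℕ =>
        (x.1.1.foldl P.natStep x.2.1, x.1.2.foldl P.natStep x.2.2))
      (q := fun _ (b : ℕ × ℕ) => P.NatLe b.1 b.2) h (sigmaPred_natLe hP hf hg),
    SigmaPred.comp_graph
      (f := fun x : (List ℕ × List ℕ) × ℕ × ℕ =>
        (x.1.1.foldl P.natStep x.2.1, x.1.2.foldl P.natStep x.2.2))
      (q := fun _ (b : ℕ × ℕ) => ¬ P.NatLe b.1 b.2) h (sigmaPred_not_natLe hP hf hg)⟩

end Definability

/-! ### Complexity of matchings -/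

section Matching

variable (P Q : OrderPresentation)

/-- A finite list of pairs of natural numbers is a matching between two presentations. -/
def IsNatMatching (σ : List (ℕ × ℕ)) : Prop :=
  (∀ a ∈ σ, P.NatLe a.1 a.1 ∧ Q.NatLe a.2 a.2) ∧
    IsSPMatching {a : P.Elem × Q.Elem | (a.1.toNat, a.2.toNat) ∈ σ}

variable {P Q} {O : Set (ℕ →. ℕ)}

/-- Membership is replaced by lookup at a position, which is primitive recursive, and all
quantifiers become universal quantifiers over coded objects. -/
theorem isNatMatching_iff (σ : List (ℕ × ℕ)) : IsNatMatching P Q σ ↔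
    ∀ i : (ℕ × ℕ) × (ℕ × ℕ) × (ℕ × ℕ), σ[i.1.1]? = some i.2.1 → σ[i.1.2]? = some i.2.2 →
      (P.NatLe i.2.1.1 i.2.1.1 ∧ Q.NatLe i.2.1.2 i.2.1.2) ∧ ∀ w : List ℕ × List ℕ,
        (P.NatLe (w.1.foldl P.natStep i.2.1.1) (w.2.foldl P.natStep i.2.2.1) ↔
          Q.NatLe (w.1.foldl Q.natStep i.2.1.2) (w.2.foldl Q.natStep i.2.2.2)) := by
  constructor
  · rintro ⟨hmem, h⟩ ⟨⟨i, j⟩, a, b⟩ ha hb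
    have ha' := hmem a (List.mem_of_getElem? ha)
    have hb' := hmem b (List.mem_of_getElem? hb)
    refine ⟨ha', ?_⟩
    obtain ⟨⟨x, hx⟩, y, hy⟩ := And.imp natLe_self_iff.1 natLe_self_iff.1 ha'
    obtain ⟨⟨z, hz⟩, u, hu⟩ := And.imp natLe_self_iff.1 natLe_self_iff.1 hb'
    obtain rfl : (x.toNat, y.toNat) = a := Prod.ext hx hy
    obtain rfl : (z.toNat, u.toNat) = b := Prod.ext hz hu
    rintro ⟨v, w⟩
    simpa only [foldl_natStep_toNat, natLe_toNat] using
      h (x, y) (List.mem_of_getElem? ha) (z, u) (List.mem_of_getElem? hb) v w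
  · intro h
    refine ⟨fun a ha => ?_, fun a ha b hb v w => ?_⟩
    · obtain ⟨i, hi⟩ := List.mem_iff_getElem?.1 ha
      exact (h ((i, i), a, a) hi hi).1
    · obtain ⟨i, hi⟩ := List.mem_iff_getElem?.1 ha
      obtain ⟨j, hj⟩ := List.mem_iff_getElem?.1 hb
      simpa only [foldl_natStep_toNat, natLe_toNat] using (h ((i, j), _, _) hi hj).2 (v, w)

/-- A failure is witnessed by an entry outside the universes, or by two entries and two words on
which the two Δ₃ inequalities disagree. -/
theorem sigmaPred_not_isNatMatching (hP : (P.diagram : ℕ →. ℕ) ∈ O)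
    (hQ : (Q.diagram : ℕ →. ℕ) ∈ O) :
    SigmaPred O 3 fun σ : List (ℕ × ℕ) => ¬ IsNatMatching P Q σ := by
  have key : SigmaPred O 3 fun σ : List (ℕ × ℕ) =>
      ∃ i : (ℕ × ℕ) × (ℕ × ℕ) × (ℕ × ℕ), σ[i.1.1]? = some i.2.1 ∧ σ[i.1.2]? = some i.2.2 ∧
        ((¬ P.NatLe i.2.1.1 i.2.1.1 ∨ ¬ Q.NatLe i.2.1.2 i.2.1.2) ∨ ∃ w : List ℕ × List ℕ,
        ((P.NatLe (w.1.foldl P.natStep i.2.1.1) (w.2.foldl P.natStep i.2.2.1) ∧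
          ¬ Q.NatLe (w.1.foldl Q.natStep i.2.1.2) (w.2.foldl Q.natStep i.2.2.2)) ∨
        (¬ P.NatLe (w.1.foldl P.natStep i.2.1.1) (w.2.foldl P.natStep i.2.2.1) ∧
          Q.NatLe (w.1.foldl Q.natStep i.2.1.2) (w.2.foldl Q.natStep i.2.2.2)))) := by
    refine .ex (.and (.eq ?_ ?_) (.and (.eq ?_ ?_) (.or (.or (sigmaPred_not_natLe hP ?_ ?_)
      (sigmaPred_not_natLe hQ ?_ ?_)) (.ex ?_))))
    on_goal 9 =>
      let f : (List (ℕ × ℕ) × (ℕ × ℕ) × (ℕ × ℕ) × (ℕ × ℕ)) × List ℕ × List ℕ →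
        (List ℕ × List ℕ) × ℕ × ℕ := fun x => (x.2, x.1.2.2.1.1, x.1.2.2.2.1)
      let g : (List (ℕ × ℕ) × (ℕ × ℕ) × (ℕ × ℕ) × (ℕ × ℕ)) × List ℕ × List ℕ →
        (List ℕ × List ℕ) × ℕ × ℕ := fun x => (x.2, x.1.2.2.1.2, x.1.2.2.2.2)
      have hf : Primrec f := by fun_prop
      have hg : Primrec g := by fun_prop
      exact .or (.and ((sigmaPred_natLe_act hP).1.comp hf) ((sigmaPred_natLe_act hQ).2.comp hg))
        (.and ((sigmaPred_natLe_act hP).2.comp hf) ((sigmaPred_natLe_act hQ).1.comp hg))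
    all_goals fun_prop
  refine key.of_iff fun σ => ?_
  rw [isNatMatching_iff]
  push Not
  refine exists_congr fun i => and_congr_right fun _ => and_congr_right fun _ => ?_
  rw [← not_and_or]
  constructor
  · intro h
    by_cases h' : P.NatLe i.2.1.1 i.2.1.1 ∧ Q.NatLe i.2.1.2 i.2.1.2
    · exact Or.inr (h h')
    · exact Or.inl h'
  · rintro (h | h) h'
    exacts [absurd h' h, h]

end Matching

end OrderPresentation

/-! ### The back-and-forth construction -/

namespace OrderPresentation

/-- At stage `i`, the element `i / 2` is put on the left or on the right, by the parity of `i`. -/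
def candidate (i b : ℕ) : ℕ × ℕ := bif i.bodd then (i.div2, b) else (b, i.div2)

theorem primrec_candidate : Primrec fun x : ℕ × ℕ => candidate x.1 x.2 :=
  Primrec.cond (Primrec.nat_bodd.comp Primrec.fst)
    ((Primrec.nat_div2.comp Primrec.fst).pair Primrec.snd)
    (Primrec.snd.pair (Primrec.nat_div2.comp Primrec.fst))

@[fun_prop]
theorem primrec_cons_candidate {α : Type*} [Primcodable α] {i b : α → ℕ} {σ : α → List (ℕ × ℕ)}
    (hi : Primrec i) (hb : Primrec b) (hσ : Primrec σ) :
    Primrec fun a => candidate (i a) (b a) :: σ a :=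
  Primrec.list_cons.comp (primrec_candidate.comp (hi.pair hb)) hσ

@[fun_prop]
theorem primrec_bodd_comp {α : Type*} [Primcodable α] {i : α → ℕ} (hi : Primrec i) :
    Primrec fun a => (i a).bodd :=
  Primrec.nat_bodd.comp hi

@[fun_prop]
theorem primrec_div2_comp {α : Type*} [Primcodable α] {i : α → ℕ} (hi : Primrec i) :
    Primrec fun a => (i a).div2 :=
  Primrec.nat_div2.comp hi

variable (P Q : OrderPresentation)

/-- The number which is treated at stage `i` is an element of the presentation. -/
def IsActive (i : ℕ) : Prop :=
  (i.bodd = true ∧ P.NatLe i.div2 i.div2) ∨ (i.bodd = false ∧ Q.NatLe i.div2 i.div2)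

/-- The step of the back-and-forth construction: add the least partner. -/
def IsStep (i : ℕ) (σ τ : List (ℕ × ℕ)) : Prop :=
  (¬ IsActive P Q i ∧ τ = σ) ∨ (IsActive P Q i ∧
    ∃ b, ¬ ¬ IsNatMatching P Q (candidate i b :: σ) ∧
      (∀ c < b, ¬ IsNatMatching P Q (candidate i c :: σ)) ∧ τ = candidate i b :: σ)

variable {P Q} {O : Set (ℕ →. ℕ)}

/-- Matching is Π₃, so it and its negation are both Σ₄; minimality of the partner adds only a
bounded quantifier. -/
theorem sigmaPred_isStep (hP : (P.diagram : ℕ →. ℕ) ∈ O) (hQ : (Q.diagram : ℕ →. ℕ) ∈ O) :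
    SigmaPred O 4 fun x : Unit × ℕ × List (ℕ × ℕ) × List (ℕ × ℕ) =>
      IsStep P Q x.2.1 x.2.2.1 x.2.2.2 := by
  have hM := sigmaPred_not_isNatMatching hP hQ
  have hA : SigmaPred O 0 fun x : Unit × ℕ × List (ℕ × ℕ) × List (ℕ × ℕ) =>
      IsActive P Q x.2.1 := by
    refine .or (.and (.eq ?_ ?_) (sigmaPred_natLe hP ?_ ?_))
      (.and (.eq ?_ ?_) (sigmaPred_natLe hQ ?_ ?_))
    all_goals fun_prop
  refine .or (.and hA.not_zero.mono_of_zero (.eq (by fun_prop) (by fun_prop)))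
    (.and hA.mono_of_zero (.ex (.and ?_ (.and (.forall_lt (by fun_prop) ?_) (.eq ?_ ?_)))))
  · exact .succ_of_not <| (hM.comp
      (f := fun x : (Unit × ℕ × List (ℕ × ℕ) × List (ℕ × ℕ)) × ℕ =>
        candidate x.1.2.1 x.2 :: x.1.2.2.1) (by fun_prop)).of_iff fun _ => not_not
  · exact .succ <| hM.comp
      (f := fun x : ((Unit × ℕ × List (ℕ × ℕ) × List (ℕ × ℕ)) × ℕ) × ℕ =>
        candidate x.1.1.2.1 x.2 :: x.1.1.2.2.1) (by fun_prop)
  · fun_prop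
  · fun_prop

theorem IsStep.unique {i : ℕ} {σ τ τ' : List (ℕ × ℕ)} (h : IsStep P Q i σ τ)
    (h' : IsStep P Q i σ τ') : τ = τ' := by
  rcases h with ⟨h, rfl⟩ | ⟨h, b, hb, hlt, rfl⟩ <;> rcases h' with ⟨h', rfl⟩ | ⟨h', c, hc, hlt', rfl⟩
  · rfl
  · exact absurd h' h
  · exact absurd h h'
  · obtain h | rfl | h := lt_trichotomy b c
    · exact absurd (hlt' _ h) hb
    · rfl
    · exact absurd (hlt _ h) hc

theorem pairs_cons (x : P.Elem) (y : Q.Elem) (σ : List (ℕ × ℕ)) :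
    {a : P.Elem × Q.Elem | (a.1.toNat, a.2.toNat) ∈ (x.toNat, y.toNat) :: σ} =
      insert (x, y) {a : P.Elem × Q.Elem | (a.1.toNat, a.2.toNat) ∈ σ} := by
  ext ⟨a, b⟩
  simp [(Elem.toNat_injective P).eq_iff, (Elem.toNat_injective Q).eq_iff]

theorem pairs_finite (σ : List (ℕ × ℕ)) :
    {a : P.Elem × Q.Elem | (a.1.toNat, a.2.toNat) ∈ σ}.Finite :=
  σ.finite_toSet.preimage
    ((Elem.toNat_injective P).prodMap (Elem.toNat_injective Q)).injOn

/-- The back-and-forth property, for lists of pairs of natural numbers. -/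
theorem exists_isStep {L : Type*} [LinearOrder L] (hL : WeaklySPHomogeneous L) (e : L ≃o P.Elem)
    (e' : L ≃o Q.Elem) : ∃ σ₀ : List (ℕ × ℕ), IsNatMatching P Q σ₀ ∧
      ∀ σ, IsNatMatching P Q σ → σ₀ ⊆ σ → ∀ i, ∃ τ, IsStep P Q i σ τ := by
  obtain ⟨s, hs, hm, h⟩ := hL.exists_insert e e'
  have hs₀ : ∀ a : P.Elem × Q.Elem,
      (a.1.toNat, a.2.toNat) ∈ hs.toFinset.toList.map (fun a => (a.1.toNat, a.2.toNat)) ↔ a ∈ s := by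
    rintro ⟨a, b⟩
    simp [(Elem.toNat_injective P).eq_iff, (Elem.toNat_injective Q).eq_iff]
  refine ⟨hs.toFinset.toList.map fun a => (a.1.toNat, a.2.toNat), ⟨?_, ?_⟩, ?_⟩
  · rintro a ha
    obtain ⟨b, -, rfl⟩ := List.mem_map.1 ha
    simp
  · simpa only [hs₀, Set.ofPred_mem_eq] using hm
  · intro σ hσ hsub i
    obtain ⟨hl, hr⟩ := h _ (pairs_finite σ) hσ.2 fun a ha => hsub ((hs₀ a).2 ha)
    by_cases hi : IsActive P Q i
    · have hex : ∃ b, IsNatMatching P Q (candidate i b :: σ) := by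
        rcases hi with ⟨hi, hd⟩ | ⟨hi, hd⟩
        · obtain ⟨x, hx⟩ := natLe_self_iff.1 hd
          obtain ⟨y, hy⟩ := hl x
          refine ⟨y.toNat, ?_⟩
          rw [candidate, hi, cond_true, ← hx]
          refine ⟨List.forall_mem_cons.2 ⟨by simp, hσ.1⟩, ?_⟩
          rwa [pairs_cons]
        · obtain ⟨y, hy⟩ := natLe_self_iff.1 hd
          obtain ⟨x, hx⟩ := hr y
          refine ⟨x.toNat, ?_⟩
          rw [candidate, hi, cond_false, ← hy]
          refine ⟨List.forall_mem_cons.2 ⟨by simp, hσ.1⟩, ?_⟩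
          rwa [pairs_cons]
      classical
      exact ⟨_, Or.inr ⟨hi, Nat.find hex, not_not.2 (Nat.find_spec hex),
        fun c hc => Nat.find_min hex hc, rfl⟩⟩
    · exact ⟨σ, Or.inl ⟨hi, rfl⟩⟩

theorem IsStep.isNatMatching {i : ℕ} {σ τ : List (ℕ × ℕ)} (h : IsStep P Q i σ τ)
    (hσ : IsNatMatching P Q σ) : IsNatMatching P Q τ := by
  rcases h with ⟨-, rfl⟩ | ⟨-, b, hb, -, rfl⟩
  exacts [hσ, not_not.1 hb]

theorem IsStep.subset {i : ℕ} {σ τ : List (ℕ × ℕ)} (h : IsStep P Q i σ τ) : σ ⊆ τ := by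
  rcases h with ⟨-, rfl⟩ | ⟨-, b, -, -, rfl⟩
  exacts [List.Subset.refl _, List.subset_cons_self _ _]

theorem exists_seq_isStep {L : Type*} [LinearOrder L] (hL : WeaklySPHomogeneous L)
    (e : L ≃o P.Elem) (e' : L ≃o Q.Elem) : ∃ F : ℕ → List (ℕ × ℕ),
      (∀ i, IsNatMatching P Q (F i)) ∧ ∀ i, IsStep P Q i (F i) (F (i + 1)) := by
  obtain ⟨σ₀, h₀, h⟩ := exists_isStep hL e e'
  -- The inclusion of `σ₀` is carried along as an invariant, since extension is guaranteed only
  -- above `σ₀`.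
  choose next hnext using fun (i : ℕ) (σ : {σ // IsNatMatching P Q σ ∧ σ₀ ⊆ σ}) =>
    h σ.1 σ.2.1 σ.2.2 i
  let F : ℕ → {σ // IsNatMatching P Q σ ∧ σ₀ ⊆ σ} := fun k =>
    k.rec ⟨σ₀, h₀, List.Subset.refl _⟩ fun i σ =>
      ⟨next i σ, (hnext i σ).isNatMatching σ.2.1, List.Subset.trans σ.2.2 (hnext i σ).subset⟩
  exact ⟨fun i => (F i).1, fun i => (F i).2.1, fun i => hnext i (F i)⟩

/-! ### The isomorphism and its graph -/

section Graph

variable {F : ℕ → List (ℕ × ℕ)}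

theorem monotone_of_isStep (hF : ∀ i, IsStep P Q i (F i) (F (i + 1))) {i j : ℕ} (hij : i ≤ j) :
    F i ⊆ F j := by
  induction hij with
  | refl => exact List.Subset.refl _
  | step _ ih => exact List.Subset.trans ih (hF _).subset

/-- Both pairs lie in a common later stage, and the empty words compare the elements themselves. -/
theorem le_iff_le_of_mem (hm : ∀ i, IsNatMatching P Q (F i))
    (hF : ∀ i, IsStep P Q i (F i) (F (i + 1))) {a b : P.Elem} {c d : Q.Elem}
    (hac : ∃ i, (a.toNat, c.toNat) ∈ F i) (hbd : ∃ i, (b.toNat, d.toNat) ∈ F i) :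
    a ≤ b ↔ c ≤ d := by
  obtain ⟨i, hi⟩ := hac
  obtain ⟨j, hj⟩ := hbd
  exact (hm (max i j)).2 (a, c) (monotone_of_isStep hF (le_max_left i j) hi) (b, d)
    (monotone_of_isStep hF (le_max_right i j) hj) [] []

theorem exists_mem_right (hm : ∀ i, IsNatMatching P Q (F i))
    (hF : ∀ i, IsStep P Q i (F i) (F (i + 1))) (a : P.Elem) :
    ∃ b : Q.Elem, ∃ i, (a.toNat, b.toNat) ∈ F i := by
  -- The element `a` is treated on the left at the odd stage `2a + 1`.
  have hA : IsActive P Q (Nat.bit true a.toNat) := Or.inl (by simp)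
  rcases hF (Nat.bit true a.toNat) with ⟨h, -⟩ | ⟨-, b, -, -, h⟩
  · exact absurd hA h
  · have hb : (a.toNat, b) ∈ F (Nat.bit true a.toNat + 1) := by
      rw [h]
      simp [candidate]
    obtain ⟨c, rfl⟩ := natLe_self_iff.1 ((hm _).1 _ hb).2
    exact ⟨c, _, hb⟩

theorem exists_mem_left (hm : ∀ i, IsNatMatching P Q (F i))
    (hF : ∀ i, IsStep P Q i (F i) (F (i + 1))) (b : Q.Elem) :
    ∃ a : P.Elem, ∃ i, (a.toNat, b.toNat) ∈ F i := by
  -- The element `b` is treated on the right at the even stage `2b`.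
  have hA : IsActive P Q (Nat.bit false b.toNat) := Or.inr (by simp)
  rcases hF (Nat.bit false b.toNat) with ⟨h, -⟩ | ⟨-, a, -, -, h⟩
  · exact absurd hA h
  · have ha : (a, b.toNat) ∈ F (Nat.bit false b.toNat + 1) := by
      rw [h]
      simp [candidate]
    obtain ⟨c, rfl⟩ := natLe_self_iff.1 ((hm _).1 _ ha).1
    exact ⟨c, _, ha⟩

theorem exists_orderIso_of_isStep (hm : ∀ i, IsNatMatching P Q (F i))
    (hF : ∀ i, IsStep P Q i (F i) (F (i + 1))) :
    ∃ f : P.Elem ≃o Q.Elem, ∀ a : P.Elem, ∃ i, (a.toNat, (f a).toNat) ∈ F i := by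
  choose f hf using exists_mem_right hm hF
  have hsurj : Function.Surjective f := fun b => by
    obtain ⟨a, ha⟩ := exists_mem_left hm hF b
    exact ⟨a, le_antisymm ((le_iff_le_of_mem hm hF (hf a) ha).1 le_rfl)
      ((le_iff_le_of_mem hm hF ha (hf a)).1 le_rfl)⟩
  exact ⟨RelIso.ofSurjective (OrderEmbedding.ofMapLEIff f fun a b =>
    (le_iff_le_of_mem hm hF (hf a) (hf b)).symm) hsurj, hf⟩

theorem sigmaPred_exists_mem (hP : (P.diagram : ℕ →. ℕ) ∈ O) (hQ : (Q.diagram : ℕ →. ℕ) ∈ O)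
    (hF : ∀ i, IsStep P Q i (F i) (F (i + 1))) :
    SigmaPred O 4 fun a : ℕ × ℕ => ∃ i, a ∈ F i := by
  have hG : SigmaPred O 4 fun x : Unit × ℕ × List (ℕ × ℕ) => F x.2.1 = x.2.2 :=
    -- The initial list is one fixed finite object, hence primitive recursive however it was found;
    -- `IsStep.unique` makes the step functional.
    SigmaPred.graph_of_step (F := fun _ => F) (R := fun _ => IsStep P Q) (Primrec.const _)
      (sigmaPred_isStep hP hQ) fun _ i c => ⟨fun h => h.unique (hF i), by rintro rfl; exact hF i⟩
  have key : SigmaPred O 4 fun a : ℕ × ℕ =>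
      ∃ x : (ℕ × ℕ) × List (ℕ × ℕ), F x.1.1 = x.2 ∧ x.2[x.1.2]? = some a := by
    refine .ex (.and (hG.comp
      (f := fun x : (ℕ × ℕ) × (ℕ × ℕ) × List (ℕ × ℕ) => ((), x.2.1.1, x.2.2)) ?_) (.eq ?_ ?_))
    all_goals fun_prop
  refine key.of_iff fun a => ?_
  simp [List.mem_iff_getElem?]

theorem mem_isoGraph_iff (hm : ∀ i, IsNatMatching P Q (F i))
    (hF : ∀ i, IsStep P Q i (F i) (F (i + 1))) {f : P.Elem ≃o Q.Elem}
    (hf : ∀ a : P.Elem, ∃ i, (a.toNat, (f a).toNat) ∈ F i) (n : ℕ) :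
    n ∈ isoGraph f ↔ ∃ i, n.unpair ∈ F i := by
  constructor
  · rintro ⟨a, rfl⟩
    simpa using hf a
  · rintro ⟨i, hi⟩
    obtain ⟨⟨a, ha⟩, b, hb⟩ := And.imp natLe_self_iff.1 natLe_self_iff.1 ((hm i).1 _ hi)
    have hab : ∃ i, (a.toNat, b.toNat) ∈ F i := ⟨i, by rwa [ha, hb]⟩
    have : f a = b := le_antisymm ((le_iff_le_of_mem hm hF (hf a) hab).1 le_rfl)
      ((le_iff_le_of_mem hm hF hab (hf a)).1 le_rfl)
    exact ⟨a, by rw [this, ha, hb, Nat.pair_unpair]⟩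

/-- A pair is off the graph exactly when its first entry is no element or has a different image.
This is again existential over the graph, so Σ₄ passes to the complement. -/
theorem not_mem_isoGraph_iff (f : P.Elem ≃o Q.Elem) (n : ℕ) :
    n ∉ isoGraph f ↔ ¬ P.NatLe n.unpair.1 n.unpair.1 ∨
      ∃ b, ¬ b = n.unpair.2 ∧ Nat.pair n.unpair.1 b ∈ isoGraph f := by
  rw [natLe_self_iff]
  constructor
  · intro hn
    by_contra! h
    obtain ⟨⟨a, ha⟩, h⟩ := h
    refine h (f a).toNat (fun hb => hn ⟨a, ?_⟩) ⟨a, by rw [ha]⟩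
    rw [ha, hb, Nat.pair_unpair]
  · rintro h ⟨a, rfl⟩
    simp only [Nat.unpair_pair] at h
    rcases h with h | ⟨b, hb, c, hc⟩
    · exact h ⟨a, rfl⟩
    · obtain ⟨hac, hbc⟩ := Nat.pair_eq_pair.1 hc
      rw [Elem.toNat_injective P hac] at hb
      exact hb hbc

end Graph

end OrderPresentation

theorem SigmaPred.isSigma {O : Set (ℕ →. ℕ)} {n : ℕ} {S : Set ℕ}
    (h : SigmaPred O n fun m => m ∈ S) : IsSigma O n S := by
  obtain ⟨T, hT, H⟩ := h
  rwa [show S = T from Set.ext H]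

open OrderPresentation in
theorem mainTheorem10 {L : Type*} [LinearOrder L] [Countable L] (hL : WeaklySPHomogeneous L) :
    RelativelyDeltaCategorical 4 L := by
  rintro P Q ⟨e⟩ ⟨e'⟩
  obtain ⟨F, hm, hF⟩ := exists_seq_isStep hL e e'
  obtain ⟨f, hf⟩ := exists_orderIso_of_isStep hm hF
  have hP : (P.diagram : ℕ →. ℕ) ∈ ({(P.diagram : ℕ →. ℕ), (Q.diagram : ℕ →. ℕ)} : Set _) :=
    Or.inl rfl
  have hG : SigmaPred {(P.diagram : ℕ →. ℕ), (Q.diagram : ℕ →. ℕ)} 4 fun n => n ∈ isoGraph f :=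
    ((sigmaPred_exists_mem hP (Or.inr rfl) hF).comp Primrec.unpair).of_iff
      (mem_isoGraph_iff hm hF hf)
  have hu : Primrec Nat.unpair := Primrec.unpair
  refine ⟨f, hG.isSigma, SigmaPred.isSigma (.of_iff (.or (sigmaPred_not_natLe hP ?_ ?_)
    (.ex (.and (.ne ?_ ?_) (hG.comp ?_)))) (not_mem_isoGraph_iff f))⟩
  · fun_prop
  · fun_prop
  · fun_prop
  · fun_prop
  · exact Primrec₂.natPair.comp (by fun_prop) (by fun_prop)
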